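/- Let $d\ge 1$, $q\ge 2$, $M,B>0$, $0<k<2$ and $C\in\mathbb{R}$. Let $G_e(M,B,k)$ be the set of functions $f:\mathbb{R}^d\to\mathbb{R}$ such that for every $u\subseteq\{1,\dots,d\}$ the mixed partial derivative $\partial^u f$ (one differentiation in each $x_j$, $j\in u$; $\partial^\emptyset f=f$) exists, is continuous, and satisfies $|\partial^u f(x)|\le B e^{M|x|^k}$ for all $x\in\mathbb{R}^d$, where $|\cdot|$ is the Euclidean norm. Let $X$ be a standard normal random vector in $\mathbb{R}^d$, let $\Phi$ be the distribution function of $N(0,1)$, and let $\Phi^{-1}$ act component-wise. For $n\ge 2$ call random points $y_1,\dots,y_n$ on a probability space an RQMC point set (with constant $C$) if each $y_j$ is uniformly distributed on $[0,1)^d$ and the star discrepancy $$D_n^*(\{y_1,\dots,y_n\})=\sup_{a\in[0,1]^d}\Big|\tfrac1n\#\{j: y_j\in[0,a)\}-\prod_{i=1}^d a_i\Big|$$ satisfies $D_n^*(\{y_1,\dots,y_n\})\le C(\log n)^{d-1}/n$ almost surely. Put $\widehat I_n(f)=\frac1n\sum_{j=1}^n f(\Phi^{-1}(y_j))$. Then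 $\mathbb{E}|f(X)|<\infty$ for every $f\in G_e(M,B,k)$, and there is a constant $K$ depending only on $M,B,k,d,q,C$ such that for all $n\ge 2$ and all RQMC point sets $y_1,\dots,y_n$ with constant $C$, $$\sup_{f\in G_e(M,B,k)}\mathbb{E}\big|\widehat I_n(f)-\mathbb{E}f(X)\big|^q\le K\,n^{-q}(\log n)^{q\left(\frac{3d}{2}-1\right)}\exp\big\{qM(4qd\log n)^{k/2}\big\}.$$ Consequently, for every $\epsilon>0$ there is a constant $K_\epsilon$ depending only on $M,B,k,d,q,C,\epsilon$ such that for all $n\ge 2$ and all such point sets the supremum on the left is at most $K_\epsilon\, n^{-q+\epsilon}$. -/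

import Mathlib

open MeasureTheory ProbabilityTheory

noncomputable section

/-- The half-open unit cube `[0,1)^d`. -/
def unitCube (d : ℕ) : Set (Fin d → ℝ) := Set.univ.pi fun _ => Set.Ico 0 1

/-- The star discrepancy of the `n`-point set (with multiplicities) `y_1, …, y_n`:
the supremum over `a ∈ [0,1]^d` of `|#{j : y_j ∈ [0,a)} / n - vol [0,a)|`, where
`[0,a) = [0,a_1) × ⋯ × [0,a_d)`. -/
def starDiscrepancy {d n : ℕ} (y : Fin n → Fin d → ℝ) : ℝ :=
  ⨆ a : Set.Icc (0 : Fin d → ℝ) 1,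
    |({j : Fin n | ∀ i, 0 ≤ y j i ∧ y j i < a.1 i}.ncard : ℝ) / n - ∏ i, a.1 i|

/-- The inverse `Φ⁻¹` of the distribution function `Φ` of `N(0,1)`, as the quantile function
`p ↦ inf {x : p ≤ Φ(x)}`. On `(0,1)` this is the inverse function of `Φ`. -/
def stdNormalQuantile (p : ℝ) : ℝ := sInf {x : ℝ | p ≤ cdf (gaussianReal 0 1) x}

/-- `Φ⁻¹` acting component-wise. -/
def stdNormalQuantileVec {d : ℕ} (y : Fin d → ℝ) : EuclideanSpace ℝ (Fin d) :=
  WithLp.toLp 2 fun i => stdNormalQuantile (y i)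

/-- The estimator `Î_n(f) = (1/n) ∑_j f (Φ⁻¹ (y_j))`. -/
def rqmcEstimator {d n : ℕ} (f : EuclideanSpace ℝ (Fin d) → ℝ) (y : Fin n → Fin d → ℝ) : ℝ :=
  (1 / (n : ℝ)) * ∑ j, f (stdNormalQuantileVec (y j))

/-- The partial derivative `∂f/∂x_j`. -/
def partialDeriv {d : ℕ} (j : Fin d) (f : EuclideanSpace ℝ (Fin d) → ℝ) :
    EuclideanSpace ℝ (Fin d) → ℝ :=
  fun x => lineDeriv ℝ f x (EuclideanSpace.single j 1)

/-- The mixed partial derivative `∂^u f`: one differentiation with respect to each `x_j`, `j ∈ u`.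
The variables are taken in a fixed order (largest index first); for functions in
`MixedSmooth` below the order is immaterial, by the symmetry of continuous mixed partials. -/
def mixedPartial {d : ℕ} (u : Finset (Fin d)) (f : EuclideanSpace ℝ (Fin d) → ℝ) :
    EuclideanSpace ℝ (Fin d) → ℝ :=
  (u.sort (· ≤ ·)).foldr partialDeriv f

/-- `f ∈ S^d(ℝ^d)`: for every `u ⊆ {1, …, d}` the mixed partial derivative `∂^u f` exists everywhere
and is continuous. The second clause is existence: `∂^(u ∪ {j}) f` is the partial derivative of
`∂^u f` with respect to `x_j` when `j` precedes all elements of `u`. -/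
def MixedSmooth {d : ℕ} (f : EuclideanSpace ℝ (Fin d) → ℝ) : Prop :=
  ∀ u : Finset (Fin d), Continuous (mixedPartial u f) ∧
    ∀ j : Fin d, (∀ i ∈ u, j < i) → ∀ x : EuclideanSpace ℝ (Fin d),
      LineDifferentiableAt ℝ (mixedPartial u f) x (EuclideanSpace.single j 1)

/-- The growth class `G_e(M,B,k)`; `‖x‖` is the Euclidean norm. -/
def growthClass (d : ℕ) (M B k : ℝ) : Set (EuclideanSpace ℝ (Fin d) → ℝ) :=
  {f | MixedSmooth f ∧ ∀ (u : Finset (Fin d)) (x : EuclideanSpace ℝ (Fin d)),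
    |mixedPartial u f x| ≤ B * Real.exp (M * ‖x‖ ^ k)}

/-- The random points `y_1, …, y_n` are each uniform on `[0,1)^d` (with no assumption on their
joint law) and almost surely have star discrepancy at most `C (log n)^(d-1) / n`. -/
def IsRQMC {Ω : Type*} [MeasurableSpace Ω] (P : Measure Ω) {d n : ℕ} (C : ℝ)
    (y : Fin n → Ω → Fin d → ℝ) : Prop :=
  (∀ j, pdf.IsUniform (y j) (unitCube d) P volume) ∧
    ∀ᵐ ω ∂P, starDiscrepancy (fun j => y j ω) ≤ C * Real.log n ^ (d - 1) / n

end

/-!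
The proof compares `f` with its truncation `g = f ∘ π`, where `π` is the coordinatewise projection
onto the cube `[-R, R]^d` and `R = √(4 q log n)`.

For the truncated integrand there is a Koksma–Hlawka inequality on `ℝ^d` itself
(`abs_integral_clamp_sub_le`). In one variable,
`φ(clamp a) = φ(R) - ∫_{-R}^{R} 1{a < s} φ'(s) ds` (`eval_clamp_eq`); applied to one coordinate
after the other, from the last to the first, it expresses `g` as a superposition of indicators of
lower boxes `{x_i < t_i, i ∈ u}` with weights `∂^u f`. Hence, by Fubini's theorem, the integrals of
`g` against two finite measures that agree up to `D` on all lower boxes differ by at most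
`D A (1 + 2R)^d`, where `A` bounds the mixed partial derivatives of `f` on the cube. The expansion
is never written out: the functions `hybrid` interpolate between `g` and indicators of lower boxes,
and the inequality is proved by induction on the number of projected coordinates.

The quantile transform maps the boxes `[0, a)` of the star discrepancy to lower boxes and the
uniform distribution to the normal one (`map_stdNormalQuantileVec`), so that the empirical measure
of the transformed points and the normal distribution may be compared with `D` the star discrepancy
(`abs_rqmcEstimator_clampComp_sub_le`). On the cube, `‖x‖² ≤ d R² = 4 q d log n`, which gives the
exponential factor of the bound; `(1 + 2R)^d` gives the power `d/2` of the logarithm.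

The truncation error `|f - g|` is at most `2 B exp(M ‖x‖^k)` and vanishes on the cube, outside of
which `1 ≤ exp((‖x‖² - R²)/4)`. As `exp(c ‖x‖^k + ‖x‖²/4)` is integrable for the normal
distribution when `k < 2`, both the first and the `q`-th moment of `|f - g|` are of order
`exp(-R²/4) = n^(-q)` (`integral_abs_sub_clampComp_rpow_le`). Every transformed point is standard
normal, so convexity of `t ↦ t^q` carries this over to the estimator without any assumption on the
joint law of the points (`IsRQMC.integrable_and_integral_error_le`).
-/

/-! ### Truncation to a cube and a one-dimensional reconstruction formula -/

/-- The projection of `a` onto the interval `[-R, R]`. -/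
noncomputable def clamp (R a : ℝ) : ℝ := max (-R) (min a R)

/-- The point whose first `m` coordinates are those of `x` projected onto `[-R, R]`, and whose
other coordinates are those of `t`. -/
noncomputable def partialClamp {d : ℕ} (R : ℝ) (m : ℕ) (t : Fin d → ℝ)
    (x : EuclideanSpace ℝ (Fin d)) : EuclideanSpace ℝ (Fin d) :=
  WithLp.toLp 2 fun i => if (i : ℕ) < m then clamp R (x i) else t i

/-- The open lower box `{x | x_i < t_i for all i ∈ u}`, unrestricted in the coordinates outside
`u`. -/
def lowerBox {d : ℕ} (u : Finset (Fin d)) (t : Fin d → ℝ) : Set (EuclideanSpace ℝ (Fin d)) :=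
  {x | ∀ i ∈ u, x i < t i}

/-- The function `1{x_i < t_i, i ∈ u} · (∂^u f)(z)`, where `z` has the coordinates of `x`
projected onto `[-R, R]` in the first `m` places and those of `t` elsewhere. For `m = d` and
`u = ∅` it is `f` composed with the projection onto `[-R, R]^d`; for `m = 0` it is a multiple of
the indicator of a lower box. -/
noncomputable def hybrid {d : ℕ} (f : EuclideanSpace ℝ (Fin d) → ℝ) (R : ℝ) (m : ℕ)
    (u : Finset (Fin d)) (t : Fin d → ℝ) : EuclideanSpace ℝ (Fin d) → ℝ :=
  (lowerBox u t).indicator fun x => mixedPartial u f (partialClamp R m t x)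

/-- `f` composed with the projection onto the cube `[-R, R]^d`. -/
noncomputable def clampComp {d : ℕ} (R : ℝ) (f : EuclideanSpace ℝ (Fin d) → ℝ) :
    EuclideanSpace ℝ (Fin d) → ℝ :=
  fun x => f (WithLp.toLp 2 fun i => clamp R (x i))

lemma abs_clamp_le {R : ℝ} (hR : 0 ≤ R) (a : ℝ) : |clamp R a| ≤ R := by
  unfold clamp
  rw [abs_le]
  exact ⟨le_max_left _ _, max_le (by linarith) (min_le_right _ _)⟩

lemma continuous_clamp (R : ℝ) : Continuous (clamp R) := by
  unfold clamp; fun_prop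

lemma continuous_clampComp {d : ℕ} (R : ℝ) {f : EuclideanSpace ℝ (Fin d) → ℝ}
    (hf : Continuous f) : Continuous (clampComp R f) := by
  have hc := continuous_clamp R
  exact hf.comp ((PiLp.continuous_toLp 2 _).comp (by fun_prop))

lemma abs_clamp_le_abs {R : ℝ} (hR : 0 ≤ R) (a : ℝ) : |clamp R a| ≤ |a| := by
  unfold clamp
  rcases le_total a R with h | h
  · rw [min_eq_left h]
    rcases le_total (-R) a with h' | h'
    · rw [max_eq_right h']
    · rw [max_eq_left h', abs_neg, abs_of_nonneg hR, abs_of_nonpos (by linarith)]; linarith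
  · rw [min_eq_right h, max_eq_right (by linarith), abs_of_nonneg hR,
      abs_of_nonneg (hR.trans h)]; exact h

lemma clamp_eq_self {R a : ℝ} (h : |a| ≤ R) : clamp R a = a := by
  unfold clamp
  rw [abs_le] at h
  rw [min_eq_left h.2, max_eq_right h.1]

/-- Reconstruction of a function of one variable on `[-R, R]` from its value at `R` and the
indicators `1{a < s}`. -/
lemma eval_clamp_eq {g g' : ℝ → ℝ} (hg : ∀ s, HasDerivAt g (g' s) s) (hg' : Continuous g')
    {R : ℝ} (hR : 0 ≤ R) (a : ℝ) :
    g (clamp R a) = g R - ∫ s in (-R)..R, (Set.Ioi a).indicator g' s := by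
  have hc : clamp R a ≤ R := (abs_le.1 (abs_clamp_le hR a)).2
  have h1 : ∫ s in (-R)..R, (Set.Ioi a).indicator g' s = ∫ s in (clamp R a)..R, g' s := by
    rw [intervalIntegral.integral_of_le (by linarith), intervalIntegral.integral_of_le hc,
      setIntegral_indicator measurableSet_Ioi]
    congr 2
    ext s
    -- `(-R, R] ∩ (a, ∞) = (clamp R a, R]`, both sides being empty when `a ≥ R`.
    simp only [clamp, Set.mem_inter_iff, Set.mem_Ioc, Set.mem_Ioi, max_lt_iff, min_lt_iff]
    grind
  rw [h1, intervalIntegral.integral_eq_sub_of_hasDerivAt (fun s _ => hg s)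
    (hg'.intervalIntegrable _ _)]
  ring

/-- Since `mixedPartial` differentiates in the largest variable first, a variable preceding all of
`u` is differentiated last. This is why coordinates are processed in decreasing order. -/
lemma mixedPartial_insert {d : ℕ} (f : EuclideanSpace ℝ (Fin d) → ℝ) {u : Finset (Fin d)}
    {j : Fin d} (hj : ∀ i ∈ u, j < i) :
    mixedPartial (insert j u) f = partialDeriv j (mixedPartial u f) := by
  unfold mixedPartial
  rw [Finset.sort_insert (· ≤ ·) (fun b hb => (hj b hb).le) (fun h => lt_irrefl _ (hj j h))]
  rfl

lemma mixedPartial_empty {d : ℕ} (f : EuclideanSpace ℝ (Fin d) → ℝ) : mixedPartial ∅ f = f := by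
  simp [mixedPartial]

lemma hybrid_top {d : ℕ} (f : EuclideanSpace ℝ (Fin d) → ℝ) (R : ℝ) (t : Fin d → ℝ)
    (x : EuclideanSpace ℝ (Fin d)) :
    hybrid f R d ∅ t x = clampComp R f x := by
  simp [clampComp, hybrid, lowerBox, mixedPartial_empty, partialClamp]

lemma partialClamp_update_add {d : ℕ} (R : ℝ) (j : Fin d) (t : Fin d → ℝ)
    (x : EuclideanSpace ℝ (Fin d)) (s h : ℝ) :
    partialClamp R j (Function.update t j (s + h)) x =
      partialClamp R j (Function.update t j s) x + h • EuclideanSpace.single j (1 : ℝ) := by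
  ext i
  by_cases hi : i = j
  · subst hi; simp [partialClamp]
  · simp [partialClamp, hi]

lemma partialClamp_succ {d : ℕ} (R : ℝ) (j : Fin d) (t : Fin d → ℝ)
    (x : EuclideanSpace ℝ (Fin d)) :
    partialClamp R (j + 1) t x =
      partialClamp R j (Function.update t j (clamp R (x j))) x := by
  ext i
  by_cases hi : i = j
  · subst hi; simp [partialClamp]
  · have : (i : ℕ) ≠ j := fun h => hi (Fin.ext h)
    have h2 : (i : ℕ) < j + 1 ↔ (i : ℕ) < j := by omega
    simp only [partialClamp, h2, Function.update_of_ne hi]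

lemma continuous_partialClamp_update {d : ℕ} (R : ℝ) (m : ℕ) (j : Fin d) (t : Fin d → ℝ) :
    Continuous fun p : ℝ × EuclideanSpace ℝ (Fin d) =>
      partialClamp R m (Function.update t j p.1) p.2 := by
  have hc := continuous_clamp R
  refine (PiLp.continuous_toLp 2 _).comp (continuous_pi fun i => ?_)
  split_ifs
  · fun_prop
  · exact (continuous_apply i).comp ((continuous_const (y := t)).update j continuous_fst)

lemma lowerBox_update {d : ℕ} {u : Finset (Fin d)} {j : Fin d} (hj : j ∉ u) (t : Fin d → ℝ)
    (s : ℝ) : lowerBox u (Function.update t j s) = lowerBox u t := by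
  ext x
  refine forall₂_congr fun i hi => ?_
  rw [Function.update_of_ne (ne_of_mem_of_not_mem hi hj)]

/-- The reconstruction formula applied in the coordinate `j`: the number of projected coordinates
goes down by one, and `j` either is frozen at `R` or joins the set of differentiated variables. -/
lemma hybrid_succ {d : ℕ} {f : EuclideanSpace ℝ (Fin d) → ℝ} (hf : MixedSmooth f) {R : ℝ}
    (hR : 0 ≤ R) {u : Finset (Fin d)} {j : Fin d} (hj : ∀ i ∈ u, j < i) (t : Fin d → ℝ)
    (x : EuclideanSpace ℝ (Fin d)) :
    hybrid f R (j + 1) u t x = hybrid f R j u (Function.update t j R) x -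
      ∫ s in (-R)..R, hybrid f R j (insert j u) (Function.update t j s) x := by
  have hju : j ∉ u := fun h => lt_irrefl _ (hj j h)
  have hmem : ∀ s, x ∈ lowerBox (insert j u) (Function.update t j s) ↔
      x j < s ∧ x ∈ lowerBox u t := by
    intro s
    rw [← lowerBox_update hju t s]
    simp [lowerBox]
  -- Outside the lower box of `u`, all three terms vanish.
  by_cases hx : x ∈ lowerBox u t
  · have hg : ∀ s, HasDerivAt
        (fun s => mixedPartial u f (partialClamp R j (Function.update t j s) x))
        (mixedPartial (insert j u) f (partialClamp R j (Function.update t j s) x)) s := by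
      intro s
      have h := ((hf u).2 j hj (partialClamp R j (Function.update t j s) x)).hasLineDerivAt
      unfold HasLineDerivAt at h
      simp only [← partialClamp_update_add] at h
      rw [mixedPartial_insert f hj, partialDeriv]
      have h2 := HasDerivAt.comp_sub_const s s (by simpa using h)
      simpa using h2
    have hc : Continuous fun s =>
        mixedPartial (insert j u) f (partialClamp R j (Function.update t j s) x) :=
      (hf _).1.comp ((continuous_partialClamp_update R j j t).comp
        (continuous_id.prodMk continuous_const))
    have h := eval_clamp_eq hg hc hR (x j)
    simp only [hybrid, Set.indicator, lowerBox_update hju, hx, if_true, hmem, and_true,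
      partialClamp_succ]
    simpa only [Set.indicator, Set.mem_Ioi] using h
  · simp [hybrid, Set.indicator, lowerBox_update hju, hx, hmem]

/-! ### A Koksma–Hlawka inequality on Euclidean space -/

lemma measurableSet_lowerBox {d : ℕ} (u : Finset (Fin d)) (t : Fin d → ℝ) :
    MeasurableSet (lowerBox u t) := by
  have : IsOpen (lowerBox u t) := by
    simp only [lowerBox, Set.ofPred_forall]
    exact isOpen_biInter_finset fun i _ => isOpen_lt (by fun_prop) continuous_const
  exact this.measurableSet

lemma isOpen_mem_lowerBox_update {d : ℕ} (u : Finset (Fin d)) (j : Fin d) (t : Fin d → ℝ) :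
    IsOpen {p : ℝ × EuclideanSpace ℝ (Fin d) | p.2 ∈ lowerBox u (Function.update t j p.1)} := by
  have h : {p : ℝ × EuclideanSpace ℝ (Fin d) | p.2 ∈ lowerBox u (Function.update t j p.1)} =
      ⋂ i ∈ u, {p | p.2 i < Function.update t j p.1 i} := by
    ext p; simp [lowerBox]
  rw [h]
  refine isOpen_biInter_finset fun i _ => isOpen_lt (by fun_prop) ?_
  exact (continuous_apply i).comp ((continuous_const (y := t)).update j continuous_fst)

lemma measurable_hybrid_update {d : ℕ} {f : EuclideanSpace ℝ (Fin d) → ℝ} (hf : MixedSmooth f)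
    (R : ℝ) (m : ℕ) (u : Finset (Fin d)) (j : Fin d) (t : Fin d → ℝ) :
    Measurable fun p : ℝ × EuclideanSpace ℝ (Fin d) =>
      hybrid f R m u (Function.update t j p.1) p.2 := by
  have h : (fun p : ℝ × EuclideanSpace ℝ (Fin d) =>
      hybrid f R m u (Function.update t j p.1) p.2) =
      {p : ℝ × EuclideanSpace ℝ (Fin d) | p.2 ∈ lowerBox u (Function.update t j p.1)}.indicator
        fun p => mixedPartial u f (partialClamp R m (Function.update t j p.1) p.2) := rfl
  rw [h]
  exact (((hf u).1.comp (continuous_partialClamp_update R m j t)).measurable).indicator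
    (isOpen_mem_lowerBox_update u j t).measurableSet

lemma measurable_hybrid {d : ℕ} {f : EuclideanSpace ℝ (Fin d) → ℝ} (hf : MixedSmooth f)
    (R : ℝ) (m : ℕ) (u : Finset (Fin d)) (t : Fin d → ℝ) : Measurable (hybrid f R m u t) := by
  have hc := continuous_clamp R
  have h : Continuous (partialClamp R m t) := by
    refine (PiLp.continuous_toLp 2 _).comp (continuous_pi fun i => ?_)
    split_ifs <;> fun_prop
  exact ((hf u).1.comp h).measurable.indicator (measurableSet_lowerBox u t)

lemma abs_hybrid_le {d : ℕ} {f : EuclideanSpace ℝ (Fin d) → ℝ} {R A : ℝ} (hR : 0 ≤ R)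
    {u : Finset (Fin d)} (hA : ∀ z : EuclideanSpace ℝ (Fin d), (∀ i, |z i| ≤ R) →
      |mixedPartial u f z| ≤ A) (m : ℕ) {t : Fin d → ℝ} (ht : ∀ i, |t i| ≤ R)
    (x : EuclideanSpace ℝ (Fin d)) : |hybrid f R m u t x| ≤ A := by
  have hz : |mixedPartial u f (partialClamp R m t x)| ≤ A := by
    refine hA _ fun i => ?_
    simp only [partialClamp]
    split_ifs
    · exact abs_clamp_le hR _
    · exact ht i
  unfold hybrid
  rw [Set.indicator]
  split_ifs
  · exact hz
  · simpa using (abs_nonneg _).trans hz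

lemma abs_update_le {d : ℕ} {R s : ℝ} {t : Fin d → ℝ} (ht : ∀ i, |t i| ≤ R) (hs : |s| ≤ R)
    (j i : Fin d) : |Function.update t j s i| ≤ R := by
  by_cases h : i = j
  · subst h; simpa using hs
  · simpa [h] using ht i

lemma integral_hybrid_succ {d : ℕ} {f : EuclideanSpace ℝ (Fin d) → ℝ} (hf : MixedSmooth f)
    {R A : ℝ} (hR : 0 ≤ R) (hA : ∀ u, ∀ z : EuclideanSpace ℝ (Fin d), (∀ i, |z i| ≤ R) →
      |mixedPartial u f z| ≤ A)
    {u : Finset (Fin d)} {j : Fin d} (hj : ∀ i ∈ u, j < i) {t : Fin d → ℝ}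
    (ht : ∀ i, |t i| ≤ R) (μ : Measure (EuclideanSpace ℝ (Fin d))) [IsFiniteMeasure μ] :
    IntervalIntegrable (fun s => ∫ x, hybrid f R j (insert j u) (Function.update t j s) x ∂μ)
      volume (-R) R ∧
    ∫ x, hybrid f R (j + 1) u t x ∂μ = ∫ x, hybrid f R j u (Function.update t j R) x ∂μ -
      ∫ s in (-R)..R, ∫ x, hybrid f R j (insert j u) (Function.update t j s) x ∂μ := by
  have hRR : -R ≤ R := by linarith
  have hint : Integrable (Function.uncurry fun (s : ℝ) (x : EuclideanSpace ℝ (Fin d)) =>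
      hybrid f R j (insert j u) (Function.update t j s) x)
      ((volume.restrict (Set.Ioc (-R) R)).prod μ) := by
    refine Integrable.of_bound (measurable_hybrid_update hf R j _ j t).aestronglyMeasurable A ?_
    have h1 : ∀ᵐ s ∂(volume.restrict (Set.Ioc (-R) R)), |s| ≤ R := by
      filter_upwards [ae_restrict_mem measurableSet_Ioc] with s hs
      exact abs_le.2 ⟨hs.1.le, hs.2⟩
    filter_upwards [Measure.quasiMeasurePreserving_fst.ae h1] with p hp
    exact abs_hybrid_le hR (hA _) _ (abs_update_le ht hp j) _
  have hint' := hint.swap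
  constructor
  · rw [intervalIntegrable_iff_integrableOn_Ioc_of_le hRR]
    exact hint.integral_prod_left
  · simp_rw [hybrid_succ hf hR hj, intervalIntegral.integral_of_le hRR]
    rw [integral_sub, integral_integral_swap (f := fun x s =>
      hybrid f R j (insert j u) (Function.update t j s) x) hint']
    · exact Integrable.of_bound (measurable_hybrid hf R j u _).aestronglyMeasurable A
        (ae_of_all _ fun x => abs_hybrid_le hR (hA _) _
          (abs_update_le ht (abs_of_nonneg hR).le j) _)
    · exact hint.integral_prod_right

/-- Koksma–Hlawka inequality for the functions `hybrid`: by induction on the number `m` of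
projected coordinates, each of which costs a factor `1 + 2R`. -/
lemma abs_integral_hybrid_sub_le {d : ℕ} {f : EuclideanSpace ℝ (Fin d) → ℝ} (hf : MixedSmooth f)
    {R A D : ℝ} (hR : 0 ≤ R) (hA : ∀ u, ∀ z : EuclideanSpace ℝ (Fin d), (∀ i, |z i| ≤ R) →
      |mixedPartial u f z| ≤ A)
    (μ ν : Measure (EuclideanSpace ℝ (Fin d))) [IsFiniteMeasure μ] [IsFiniteMeasure ν]
    (hD : ∀ u t, |μ.real (lowerBox u t) - ν.real (lowerBox u t)| ≤ D) (m : ℕ) (hm : m ≤ d) :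
    ∀ u : Finset (Fin d), (∀ i ∈ u, m ≤ (i : ℕ)) → ∀ t : Fin d → ℝ, (∀ i, |t i| ≤ R) →
      |∫ x, hybrid f R m u t x ∂μ - ∫ x, hybrid f R m u t x ∂ν| ≤ D * A * (1 + 2 * R) ^ m := by
  induction m with
  | zero =>
    intro u _ t ht
    have h : hybrid f R 0 u t =
        (lowerBox u t).indicator fun _ => mixedPartial u f (WithLp.toLp 2 t) := by
      simp [hybrid, partialClamp]
    have hmeas := measurableSet_lowerBox u t
    rw [h, integral_indicator_const _ hmeas, integral_indicator_const _ hmeas, ← sub_smul,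
      smul_eq_mul, abs_mul, pow_zero, mul_one]
    exact mul_le_mul (hD u t) (hA u _ ht) (abs_nonneg _) ((abs_nonneg _).trans (hD u t))
  | succ m ih =>
    intro u hu t ht
    let j : Fin d := ⟨m, hm⟩
    have hj : ∀ i ∈ u, j < i := fun i hi => Fin.lt_def.2 (hu i hi)
    have hRR : -R ≤ R := by linarith
    obtain ⟨hiμ, hμ⟩ := integral_hybrid_succ hf hR hA hj ht μ
    obtain ⟨hiν, hν⟩ := integral_hybrid_succ hf hR hA hj ht ν
    have h1 := ih (by omega) u (fun i hi => (Nat.le_succ m).trans (hu i hi))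
      (Function.update t j R) (abs_update_le ht (abs_of_nonneg hR).le j)
    have h2 : ∀ s ∈ Set.uIoc (-R) R,
        ‖∫ x, hybrid f R j (insert j u) (Function.update t j s) x ∂μ -
          ∫ x, hybrid f R j (insert j u) (Function.update t j s) x ∂ν‖ ≤
            D * A * (1 + 2 * R) ^ m := by
      intro s hs
      rw [Set.uIoc_of_le hRR] at hs
      refine ih (by omega) (insert j u) ?_ _
        (abs_update_le ht (abs_le.2 ⟨hs.1.le, hs.2⟩) j)
      intro i hi
      rcases Finset.mem_insert.1 hi with rfl | hi
      · exact le_rfl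
      · exact (Nat.le_succ m).trans (hu i hi)
    have h3 := intervalIntegral.norm_integral_le_of_norm_le_const h2
    rw [intervalIntegral.integral_sub hiμ hiν, Real.norm_eq_abs,
      show |R - -R| = 2 * R by rw [abs_of_nonneg] <;> linarith] at h3
    change |∫ x, hybrid f R (j + 1) u t x ∂μ - ∫ x, hybrid f R (j + 1) u t x ∂ν| ≤ _
    rw [hμ, hν, sub_sub_sub_comm, pow_succ]
    calc _ ≤ _ := abs_sub _ _
      _ ≤ D * A * (1 + 2 * R) ^ m + D * A * (1 + 2 * R) ^ m * (2 * R) := add_le_add h1 h3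
      _ = _ := by ring

/-- If two finite measures differ by at most `D` on all lower boxes, then their integrals of `f`
composed with the projection onto the cube `[-R, R]^d` differ by at most `D A (1 + 2R)^d`, where
`A` bounds all mixed partial derivatives of `f` on the cube. -/
theorem abs_integral_clamp_sub_le {d : ℕ} {f : EuclideanSpace ℝ (Fin d) → ℝ} (hf : MixedSmooth f)
    {R A D : ℝ} (hR : 0 ≤ R) (hA : ∀ u, ∀ z : EuclideanSpace ℝ (Fin d), (∀ i, |z i| ≤ R) →
      |mixedPartial u f z| ≤ A)
    (μ ν : Measure (EuclideanSpace ℝ (Fin d))) [IsFiniteMeasure μ] [IsFiniteMeasure ν]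
    (hD : ∀ u t, |μ.real (lowerBox u t) - ν.real (lowerBox u t)| ≤ D) :
    |∫ x, clampComp R f x ∂μ -
      ∫ x, clampComp R f x ∂ν| ≤ D * A * (1 + 2 * R) ^ d := by
  have h := abs_integral_hybrid_sub_le hf hR hA μ ν hD d le_rfl ∅ (by simp) 0
    (fun i => by simpa using hR)
  simpa only [hybrid_top] using h

/-! ### The normal quantile function -/

lemma strictMono_cdf_gaussian : StrictMono (cdf (gaussianReal 0 1)) := by
  intro a b hab
  have h : (cdf (gaussianReal 0 1)).measure (Set.Ioc a b) ≠ 0 := by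
    rw [measure_cdf]
    intro h0
    have := gaussianReal_absolutelyContinuous' 0 (one_ne_zero : (1 : NNReal) ≠ 0) h0
    simp [hab.not_ge] at this
  rw [StieltjesFunction.measure_Ioc, Ne, ENNReal.ofReal_eq_zero, not_le] at h
  linarith

lemma continuous_cdf_gaussian : Continuous (cdf (gaussianReal 0 1)) := by
  have hna := nullSingletonClass_gaussianReal (μ := 0) (one_ne_zero : (1 : NNReal) ≠ 0)
  rw [continuous_iff_continuousAt]
  intro x
  rw [(monotone_cdf _).continuousAt_iff_leftLim_eq_rightLim, StieltjesFunction.rightLim_eq]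
  have h : (cdf (gaussianReal 0 1)).measure {x} = 0 := by
    rw [measure_cdf]; exact measure_singleton x
  rw [StieltjesFunction.measure_singleton, ENNReal.ofReal_eq_zero] at h
  exact le_antisymm ((monotone_cdf _).leftLim_le le_rfl) (by linarith)

lemma cdf_stdNormalQuantile {p : ℝ} (h0 : 0 < p) (h1 : p < 1) :
    cdf (gaussianReal 0 1) (stdNormalQuantile p) = p := by
  obtain ⟨c, hc⟩ := mem_range_of_exists_le_of_exists_ge continuous_cdf_gaussian
    ((tendsto_cdf_atBot (gaussianReal 0 1)).eventually_le_const h0).exists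
    ((tendsto_cdf_atTop (gaussianReal 0 1)).eventually_const_le h1).exists
  have h : stdNormalQuantile p = c := by
    unfold stdNormalQuantile
    have : {x : ℝ | p ≤ cdf (gaussianReal 0 1) x} = Set.Ici c := by
      ext x
      simp only [← hc, Set.mem_ofPred_eq, Set.mem_Ici, strictMono_cdf_gaussian.le_iff_le]
    rw [this, csInf_Ici]
  rw [h, hc]

lemma stdNormalQuantile_lt_iff {p : ℝ} (h0 : 0 < p) (h1 : p < 1) (x : ℝ) :
    stdNormalQuantile p < x ↔ p < cdf (gaussianReal 0 1) x := by
  rw [← strictMono_cdf_gaussian.lt_iff_lt, cdf_stdNormalQuantile h0 h1]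

lemma stdNormalQuantile_le_iff {p : ℝ} (h0 : 0 < p) (h1 : p < 1) (x : ℝ) :
    stdNormalQuantile p ≤ x ↔ p ≤ cdf (gaussianReal 0 1) x := by
  rw [← strictMono_cdf_gaussian.le_iff_le, cdf_stdNormalQuantile h0 h1]

lemma cdf_gaussian_lt_one (x : ℝ) : cdf (gaussianReal 0 1) x < 1 :=
  (strictMono_cdf_gaussian (by linarith : x < x + 1)).trans_le (cdf_le_one _ _)

/-- Outside `(0, 1)` the infimum defining the quantile function is over `∅` or over `ℝ`, and
takes the value `0` by convention. -/
lemma stdNormalQuantile_eq_zero {p : ℝ} (h : ¬ (0 < p ∧ p < 1)) : stdNormalQuantile p = 0 := by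
  unfold stdNormalQuantile
  rcases le_or_gt p 0 with h0 | h0
  · have : {x : ℝ | p ≤ cdf (gaussianReal 0 1) x} = Set.univ :=
      Set.eq_univ_of_forall fun x => h0.trans (cdf_nonneg _ x)
    rw [this, Real.sInf_univ]
  · have h1 : 1 ≤ p := not_lt.1 fun h1 => h ⟨h0, h1⟩
    have : {x : ℝ | p ≤ cdf (gaussianReal 0 1) x} = ∅ :=
      Set.eq_empty_of_forall_notMem fun x hx => absurd (cdf_gaussian_lt_one x) (h1.trans hx).not_gt
    rw [this, Real.sInf_empty]

lemma measurable_stdNormalQuantile : Measurable stdNormalQuantile := by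
  refine measurable_of_Iio fun x => ?_
  have h : stdNormalQuantile ⁻¹' Set.Iio x =
      (Set.Ioo 0 1 ∩ Set.Iio (cdf (gaussianReal 0 1) x)) ∪ ((Set.Ioo 0 1)ᶜ ∩ {_p | 0 < x}) := by
    ext p
    by_cases hp : 0 < p ∧ p < 1
    · simp [stdNormalQuantile_lt_iff hp.1 hp.2, hp.1, hp.2]
    · simp only [Set.mem_preimage, Set.mem_Iio, stdNormalQuantile_eq_zero hp, Set.mem_union,
        Set.mem_inter_iff, Set.mem_Ioo, hp, Set.mem_compl_iff, Set.mem_ofPred_eq]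
      simp
  rw [h]
  exact (measurableSet_Ioo.inter measurableSet_Iio).union
    (measurableSet_Ioo.compl.inter (MeasurableSet.const _))

lemma measurable_stdNormalQuantileVec {d : ℕ} :
    Measurable (stdNormalQuantileVec : (Fin d → ℝ) → EuclideanSpace ℝ (Fin d)) := by
  refine (WithLp.measurable_toLp 2 _).comp (measurable_pi_lambda _ fun i => ?_)
  exact measurable_stdNormalQuantile.comp (measurable_pi_apply i)

lemma map_stdNormalQuantile :
    (volume.restrict (Set.Ico (0 : ℝ) 1)).map stdNormalQuantile = gaussianReal 0 1 := by
  refine Measure.ext_of_Iic _ _ fun x => ?_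
  rw [Measure.map_apply measurable_stdNormalQuantile measurableSet_Iic,
    ← restrict_Ioo_eq_restrict_Ico,
    Measure.restrict_apply (measurable_stdNormalQuantile measurableSet_Iic), ← ofReal_cdf]
  have h : stdNormalQuantile ⁻¹' Set.Iic x ∩ Set.Ioo 0 1 =
      Set.Ioc 0 (cdf (gaussianReal 0 1) x) := by
    ext p
    simp only [Set.mem_inter_iff, Set.mem_preimage, Set.mem_Iic, Set.mem_Ioo, Set.mem_Ioc]
    constructor
    · rintro ⟨h, h0, h1⟩
      exact ⟨h0, (stdNormalQuantile_le_iff h0 h1 x).1 h⟩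
    · rintro ⟨h0, h⟩
      have h1 := h.trans_lt (cdf_gaussian_lt_one x)
      exact ⟨(stdNormalQuantile_le_iff h0 h1 x).2 h, h0, h1⟩
  rw [h, Real.volume_Ioc, sub_zero]

lemma volume_unitCube (d : ℕ) : volume (unitCube d) = 1 := by
  rw [unitCube, volume_pi_pi]; simp

lemma cond_unitCube (d : ℕ) : ProbabilityTheory.cond volume (unitCube d) =
    Measure.pi fun _ : Fin d => volume.restrict (Set.Ico (0 : ℝ) 1) := by
  rw [ProbabilityTheory.cond, volume_unitCube, inv_one, one_smul, unitCube, volume_pi,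
    Measure.restrict_pi_pi]

/-- The component-wise quantile transform takes the uniform distribution on the cube to the
standard normal distribution. -/
lemma map_stdNormalQuantileVec (d : ℕ) :
    (ProbabilityTheory.cond volume (unitCube d)).map stdNormalQuantileVec =
      stdGaussian (EuclideanSpace ℝ (Fin d)) := by
  have hsf : ∀ _ : Fin d,
      SigmaFinite ((volume.restrict (Set.Ico (0 : ℝ) 1)).map stdNormalQuantile) := fun _ => by
    rw [map_stdNormalQuantile]; infer_instance
  rw [cond_unitCube, ← map_pi_eq_stdGaussian, ← map_stdNormalQuantile,
    ← Measure.pi_map_pi (fun _ => measurable_stdNormalQuantile.aemeasurable), Measure.map_map]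
  · rfl
  · exact WithLp.measurable_toLp 2 _
  · exact measurable_pi_lambda _ fun i => measurable_stdNormalQuantile.comp (measurable_pi_apply i)

/-! ### Empirical measures and the star discrepancy -/

/-- The uniform probability measure on the points `z_1, …, z_n`, with multiplicities. -/
noncomputable def empiricalMeasure {E : Type*} [MeasurableSpace E] {n : ℕ} (z : Fin n → E) :
    Measure E := (n : ENNReal)⁻¹ • ∑ j, Measure.dirac (z j)

lemma isFiniteMeasure_empiricalMeasure {E : Type*} [MeasurableSpace E] {n : ℕ} (hn : 0 < n)
    (z : Fin n → E) : IsFiniteMeasure (empiricalMeasure z) := by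
  have : (n : ENNReal)⁻¹ ≠ ⊤ := by simp [hn.ne']
  exact Measure.smul_finite _ this

lemma integral_empiricalMeasure {E : Type*} [MeasurableSpace E] {n : ℕ} (z : Fin n → E)
    {g : E → ℝ} (hg : Measurable g) :
    ∫ x, g x ∂(empiricalMeasure z) = (1 / (n : ℝ)) * ∑ j, g (z j) := by
  have h : ∀ j ∈ Finset.univ, Integrable g (Measure.dirac (z j)) := fun j _ =>
    integrable_dirac' hg.stronglyMeasurable (by simp)
  rw [empiricalMeasure, integral_smul_measure, integral_finsetSum_measure h]
  simp [integral_dirac' _ _ hg.stronglyMeasurable]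

lemma measureReal_empiricalMeasure {E : Type*} [MeasurableSpace E] {n : ℕ} (z : Fin n → E)
    {s : Set E} (hs : MeasurableSet s) :
    (empiricalMeasure z).real s = ({j | z j ∈ s}.ncard : ℝ) / n := by
  classical
  rw [measureReal_def, empiricalMeasure, Measure.smul_apply, Measure.finsetSum_apply]
  simp only [Measure.dirac_apply' _ hs, Set.indicator_apply, Pi.one_apply]
  rw [Finset.sum_boole, Set.ncard_eq_toFinset_card']
  simp [div_eq_inv_mul]

lemma measureReal_stdGaussian_lowerBox {d : ℕ} (u : Finset (Fin d)) (t : Fin d → ℝ) :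
    (stdGaussian (EuclideanSpace ℝ (Fin d))).real (lowerBox u t) =
      ∏ i, if i ∈ u then cdf (gaussianReal 0 1) (t i) else 1 := by
  have hna := nullSingletonClass_gaussianReal (μ := 0) (one_ne_zero : (1 : NNReal) ≠ 0)
  have h : WithLp.toLp 2 ⁻¹' lowerBox u t =
      Set.univ.pi fun i => if i ∈ u then Set.Iio (t i) else Set.univ := by
    ext x
    simp only [lowerBox, Set.mem_preimage, Set.mem_ofPred_eq, Set.mem_pi, Set.mem_univ,
      true_imp_iff]
    refine forall_congr' fun i => ?_
    by_cases hi : i ∈ u <;> simp [hi]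
  rw [measureReal_def, ← map_pi_eq_stdGaussian,
    Measure.map_apply (WithLp.measurable_toLp 2 _) (measurableSet_lowerBox u t), h,
    Measure.pi_pi, ENNReal.toReal_prod]
  refine Finset.prod_congr rfl fun i _ => ?_
  split_ifs
  · rw [cdf_eq_real, measureReal_def, measure_congr Iio_ae_eq_Iic]
  · simp

lemma abs_count_sub_prod_le_starDiscrepancy {d n : ℕ} (y : Fin n → Fin d → ℝ) {a : Fin d → ℝ}
    (ha : a ∈ Set.Icc (0 : Fin d → ℝ) 1) :
    |({j : Fin n | ∀ i, 0 ≤ y j i ∧ y j i < a i}.ncard : ℝ) / n - ∏ i, a i| ≤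
      starDiscrepancy y := by
  refine le_ciSup (f := fun a : Set.Icc (0 : Fin d → ℝ) 1 =>
    |({j : Fin n | ∀ i, 0 ≤ y j i ∧ y j i < a.1 i}.ncard : ℝ) / n - ∏ i, a.1 i|) ?_ ⟨a, ha⟩
  refine ⟨1, ?_⟩
  rintro _ ⟨b, rfl⟩
  have h1 : ({j : Fin n | ∀ i, 0 ≤ y j i ∧ y j i < b.1 i}.ncard : ℝ) ≤ n := by
    have := Set.ncard_le_card {j : Fin n | ∀ i, 0 ≤ y j i ∧ y j i < b.1 i}
    simp only [Nat.card_eq_fintype_card, Fintype.card_fin] at this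
    exact_mod_cast this
  have h2 := div_le_one_of_le₀ h1 n.cast_nonneg
  have h3 : (0 : ℝ) ≤ ({j : Fin n | ∀ i, 0 ≤ y j i ∧ y j i < b.1 i}.ncard : ℝ) / n := by positivity
  have h4 : 0 ≤ ∏ i, b.1 i := Finset.prod_nonneg fun i _ => b.2.1 i
  have h5 : ∏ i, b.1 i ≤ 1 := Finset.prod_le_one (fun i _ => b.2.1 i) fun i _ => b.2.2 i
  exact abs_le.2 ⟨by linarith, by linarith⟩

/-- After the quantile transform, lower boxes become boxes `[0, a)` in the cube, with
`a_i = Φ(t_i)` for `i ∈ u` and `a_i = 1` otherwise. -/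
lemma abs_empiricalMeasure_lowerBox_sub_le {d n : ℕ} {y : Fin n → Fin d → ℝ}
    (hy : ∀ j i, 0 < y j i ∧ y j i < 1) (u : Finset (Fin d)) (t : Fin d → ℝ) :
    |(empiricalMeasure fun j => stdNormalQuantileVec (y j)).real (lowerBox u t) -
      (stdGaussian (EuclideanSpace ℝ (Fin d))).real (lowerBox u t)| ≤ starDiscrepancy y := by
  set a : Fin d → ℝ := fun i => if i ∈ u then cdf (gaussianReal 0 1) (t i) else 1 with ha
  have ha' : a ∈ Set.Icc (0 : Fin d → ℝ) 1 := by
    constructor <;> intro i <;> simp only [ha, Pi.zero_apply, Pi.one_apply] <;> split_ifs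
    · exact cdf_nonneg _ _
    · exact zero_le_one
    · exact cdf_le_one _ _
    · exact le_rfl
  have h : {j | stdNormalQuantileVec (y j) ∈ lowerBox u t} =
      {j | ∀ i, 0 ≤ y j i ∧ y j i < a i} := by
    ext j
    refine forall_congr' fun i => ?_
    by_cases hi : i ∈ u
    · simp [hi, ha, stdNormalQuantileVec, stdNormalQuantile_lt_iff (hy j i).1 (hy j i).2,
        (hy j i).1.le]
    · simp [hi, ha, (hy j i).1.le, (hy j i).2]
  rw [measureReal_empiricalMeasure _ (measurableSet_lowerBox u t),
    measureReal_stdGaussian_lowerBox, h]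
  exact abs_count_sub_prod_le_starDiscrepancy y ha'

/-- Error of the estimator for the truncated integrand. The points have to avoid the lower faces of
the cube, where `stdNormalQuantile` is not the inverse of the distribution function. -/
lemma abs_rqmcEstimator_clampComp_sub_le {d n : ℕ} (hn : 0 < n)
    {f : EuclideanSpace ℝ (Fin d) → ℝ} (hf : MixedSmooth f)
    {R A : ℝ} (hR : 0 ≤ R) (hA : ∀ u, ∀ z : EuclideanSpace ℝ (Fin d), (∀ i, |z i| ≤ R) →
      |mixedPartial u f z| ≤ A) {y : Fin n → Fin d → ℝ} (hy : ∀ j i, 0 < y j i ∧ y j i < 1) :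
    |rqmcEstimator (clampComp R f) y -
      ∫ x, clampComp R f x ∂(stdGaussian (EuclideanSpace ℝ (Fin d)))| ≤
        starDiscrepancy y * A * (1 + 2 * R) ^ d := by
  have := isFiniteMeasure_empiricalMeasure hn fun j => stdNormalQuantileVec (y j)
  have h := abs_integral_clamp_sub_le hf hR hA
    (empiricalMeasure fun j => stdNormalQuantileVec (y j)) (stdGaussian _)
    (abs_empiricalMeasure_lowerBox_sub_le hy)
  have hfc : Continuous f := by simpa [mixedPartial_empty] using (hf ∅).1
  rwa [integral_empiricalMeasure _ (continuous_clampComp R hfc).measurable] at h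

/-! ### Growth and Gaussian integrability -/

/-- A power with exponent less than one is dominated by a linear function of arbitrarily small
slope. -/
lemma exists_mul_rpow_le {κ : ℝ} (hκ0 : 0 < κ) (hκ1 : κ < 1) (c : ℝ) {ε : ℝ} (hε : 0 < ε) :
    ∃ K : ℝ, ∀ L : ℝ, 0 ≤ L → c * L ^ κ ≤ ε * L + K := by
  have hc : 0 < |c| + 1 := by positivity
  obtain ⟨L₀, hL₀⟩ := Filter.eventually_atTop.1
    (((tendsto_rpow_neg_atTop (sub_pos.2 hκ1)).eventually_le_const (div_pos hε hc)).and
      (Filter.eventually_gt_atTop 0))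
  refine ⟨|c| * |L₀| ^ κ, fun L hL => ?_⟩
  have h1 : c * L ^ κ ≤ |c| * L ^ κ := by gcongr; exact le_abs_self c
  rcases le_total L₀ L with h | h
  · obtain ⟨h2, hL0⟩ := hL₀ L h
    have h3 : L ^ κ = L ^ (-(1 - κ)) * L := by
      conv_rhs => rw [← Real.rpow_one L, ← Real.rpow_mul hL0.le, ← Real.rpow_add hL0]
      congr 1
      ring
    have h4 : |c| * L ^ κ ≤ (|c| + 1) * (ε / (|c| + 1) * L) := by
      rw [h3]; gcongr; linarith
    rw [← mul_assoc, mul_div_cancel₀ _ hc.ne'] at h4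
    have : 0 ≤ |c| * |L₀| ^ κ := by positivity
    linarith
  · have h2 : |c| * L ^ κ ≤ |c| * |L₀| ^ κ := by gcongr; exact h.trans (le_abs_self _)
    have : 0 ≤ ε * L := by positivity
    linarith

lemma integrable_exp_mul_sq_gaussianReal {a : ℝ} (ha : a < 1 / 2) :
    Integrable (fun x : ℝ => Real.exp (a * x ^ 2)) (gaussianReal 0 1) := by
  rw [gaussianReal_of_var_ne_zero _ one_ne_zero,
    integrable_withDensity_iff_integrable_smul₀' (measurable_gaussianPDF 0 1).aemeasurable
      (ae_of_all _ fun _ => gaussianPDF_lt_top)]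
  refine ((integrable_exp_neg_mul_sq (b := 1 / 2 - a) (by linarith)).const_mul
    (√(2 * Real.pi))⁻¹).congr (ae_of_all _ fun x => ?_)
  simp only [toReal_gaussianPDF, gaussianPDFReal, smul_eq_mul, NNReal.coe_one, mul_one, sub_zero]
  rw [mul_assoc, ← Real.exp_add]
  ring_nf

lemma integrable_exp_mul_norm_sq_stdGaussian (d : ℕ) {a : ℝ} (ha : a < 1 / 2) :
    Integrable (fun x => Real.exp (a * ‖x‖ ^ 2)) (stdGaussian (EuclideanSpace ℝ (Fin d))) := by
  rw [← map_pi_eq_stdGaussian, integrable_map_measure (by fun_prop)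
    (WithLp.measurable_toLp 2 _).aemeasurable]
  refine (Integrable.fintype_prod (f := fun (_ : Fin d) x => Real.exp (a * x ^ 2))
    fun _ => integrable_exp_mul_sq_gaussianReal ha).congr (ae_of_all _ fun x => ?_)
  simp [EuclideanSpace.norm_sq_eq, Finset.mul_sum, Real.exp_sum]

lemma norm_rpow_eq {E : Type*} [SeminormedAddGroup E] (x : E) (k : ℝ) :
    ‖x‖ ^ k = (‖x‖ ^ 2) ^ (k / 2) := by
  rw [← Real.rpow_natCast, ← Real.rpow_mul (norm_nonneg _)]
  congr 1
  push_cast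
  ring

/-- The weight `exp(‖x‖²/4)` leaves room to absorb a Gaussian tail into an integrable function. -/
lemma integrable_exp_norm_rpow_add_sq (d : ℕ) {k : ℝ} (hk0 : 0 < k) (hk2 : k < 2) (c : ℝ) :
    Integrable (fun x => Real.exp (c * ‖x‖ ^ k + ‖x‖ ^ 2 / 4))
      (stdGaussian (EuclideanSpace ℝ (Fin d))) := by
  obtain ⟨K, hK⟩ := exists_mul_rpow_le (κ := k / 2) (by linarith) (by linarith) c
    (ε := 1 / 8) (by norm_num)
  have hm : Continuous fun x : EuclideanSpace ℝ (Fin d) =>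
      Real.exp (c * ‖x‖ ^ k + ‖x‖ ^ 2 / 4) := by
    fun_prop (disch := exact hk0.le)
  refine ((integrable_exp_mul_norm_sq_stdGaussian d (a := 3 / 8) (by norm_num)).const_mul
    (Real.exp K)).mono' hm.aestronglyMeasurable (ae_of_all _ fun x => ?_)
  rw [Real.norm_of_nonneg (Real.exp_pos _).le, ← Real.exp_add, Real.exp_le_exp, norm_rpow_eq]
  have := hK (‖x‖ ^ 2) (by positivity)
  linarith

lemma integrable_exp_norm_rpow (d : ℕ) {k : ℝ} (hk0 : 0 < k) (hk2 : k < 2) (c : ℝ) :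
    Integrable (fun x => Real.exp (c * ‖x‖ ^ k)) (stdGaussian (EuclideanSpace ℝ (Fin d))) := by
  have hm : Continuous fun x : EuclideanSpace ℝ (Fin d) => Real.exp (c * ‖x‖ ^ k) := by
    fun_prop (disch := exact hk0.le)
  refine (integrable_exp_norm_rpow_add_sq d hk0 hk2 c).mono' hm.aestronglyMeasurable
    (ae_of_all _ fun x => ?_)
  rw [Real.norm_of_nonneg (Real.exp_pos _).le, Real.exp_le_exp]
  have : 0 ≤ ‖x‖ ^ 2 / 4 := by positivity
  linarith

section GrowthClass

variable {d : ℕ} {M B k : ℝ} {f : EuclideanSpace ℝ (Fin d) → ℝ}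

lemma continuous_of_mem_growthClass (hf : f ∈ growthClass d M B k) : Continuous f := by
  simpa [mixedPartial_empty] using (hf.1 ∅).1

lemma abs_le_of_mem_growthClass (hf : f ∈ growthClass d M B k) (x : EuclideanSpace ℝ (Fin d)) :
    |f x| ≤ B * Real.exp (M * ‖x‖ ^ k) := by
  simpa [mixedPartial_empty] using hf.2 ∅ x

lemma mul_exp_rpow (hB : 0 < B) (p s : ℝ) :
    (B * Real.exp s) ^ p = B ^ p * Real.exp (p * s) := by
  rw [Real.mul_rpow hB.le (Real.exp_pos _).le, ← Real.exp_mul, mul_comm s p]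

lemma integrable_abs_rpow (hB : 0 < B) (hk0 : 0 < k) (hk2 : k < 2)
    (hf : f ∈ growthClass d M B k) {p : ℝ} (hp : 0 ≤ p) :
    Integrable (fun x => |f x| ^ p) (stdGaussian (EuclideanSpace ℝ (Fin d))) := by
  refine ((integrable_exp_norm_rpow d hk0 hk2 (p * M)).const_mul (B ^ p)).mono'
    ?_ (ae_of_all _ fun x => ?_)
  · exact ((continuous_of_mem_growthClass hf).abs.measurable.pow_const p).aestronglyMeasurable
  · rw [Real.norm_of_nonneg (by positivity), mul_assoc, ← mul_exp_rpow hB]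
    exact Real.rpow_le_rpow (abs_nonneg _) (abs_le_of_mem_growthClass hf x) hp

lemma integrable_of_mem_growthClass (hB : 0 < B) (hk0 : 0 < k) (hk2 : k < 2)
    (hf : f ∈ growthClass d M B k) : Integrable f (stdGaussian (EuclideanSpace ℝ (Fin d))) := by
  have h := integrable_abs_rpow hB hk0 hk2 hf zero_le_one
  simp only [Real.rpow_one] at h
  exact (integrable_norm_iff (continuous_of_mem_growthClass hf).aestronglyMeasurable).1 h

lemma norm_clamp_le {R : ℝ} (hR : 0 ≤ R) (x : EuclideanSpace ℝ (Fin d)) :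
    ‖(WithLp.toLp 2 fun i => clamp R (x i) : EuclideanSpace ℝ (Fin d))‖ ≤ ‖x‖ := by
  rw [EuclideanSpace.norm_eq, EuclideanSpace.norm_eq]
  refine Real.sqrt_le_sqrt (Finset.sum_le_sum fun i _ => ?_)
  exact pow_le_pow_left₀ (norm_nonneg _) (abs_clamp_le_abs hR (x i)) 2

/-- The truncation error vanishes on the cube, and outside of it `exp((‖x‖² - R²)/4) ≥ 1`. -/
lemma abs_sub_clampComp_rpow_le (hM : 0 < M) (hB : 0 < B) (hk0 : 0 < k)
    (hf : f ∈ growthClass d M B k) {p : ℝ} (hp : 0 < p) {R : ℝ} (hR : 0 ≤ R)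
    (x : EuclideanSpace ℝ (Fin d)) :
    |f x - clampComp R f x| ^ p ≤
      (2 * B) ^ p * Real.exp (-R ^ 2 / 4) * Real.exp (p * M * ‖x‖ ^ k + ‖x‖ ^ 2 / 4) := by
  by_cases hx : ∀ i, |x i| ≤ R
  · have : clampComp R f x = f x := by
      unfold clampComp
      congr 1
      ext i
      exact clamp_eq_self (hx i)
    rw [this, sub_self, abs_zero, Real.zero_rpow hp.ne']
    positivity
  · push Not at hx
    obtain ⟨i, hi⟩ := hx
    have h1 : R ^ 2 ≤ ‖x‖ ^ 2 := by
      have : |x i| ≤ ‖x‖ := by simpa using PiLp.norm_apply_le x i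
      exact pow_le_pow_left₀ hR (hi.le.trans this) 2
    have h2 : |clampComp R f x| ≤ B * Real.exp (M * ‖x‖ ^ k) := by
      refine (abs_le_of_mem_growthClass hf _).trans ?_
      have := Real.rpow_le_rpow (norm_nonneg _) (norm_clamp_le hR x) hk0.le
      gcongr
    have h3 : |f x - clampComp R f x| ≤ 2 * B * Real.exp (M * ‖x‖ ^ k) := by
      have := abs_sub (f x) (clampComp R f x)
      have := abs_le_of_mem_growthClass hf x
      linarith
    calc |f x - clampComp R f x| ^ p ≤ (2 * B * Real.exp (M * ‖x‖ ^ k)) ^ p := by gcongr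
      _ = (2 * B) ^ p * Real.exp (p * (M * ‖x‖ ^ k)) := mul_exp_rpow (by positivity) _ _
      _ ≤ (2 * B) ^ p * Real.exp (-R ^ 2 / 4 + (p * M * ‖x‖ ^ k + ‖x‖ ^ 2 / 4)) := by
        gcongr; linarith
      _ = _ := by rw [Real.exp_add]; ring

lemma integrable_abs_sub_clampComp_rpow (hM : 0 < M) (hB : 0 < B) (hk0 : 0 < k) (hk2 : k < 2)
    (hf : f ∈ growthClass d M B k) {p : ℝ} (hp : 0 < p) {R : ℝ} (hR : 0 ≤ R) :
    Integrable (fun x => |f x - clampComp R f x| ^ p)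
      (stdGaussian (EuclideanSpace ℝ (Fin d))) := by
  have hc := continuous_of_mem_growthClass hf
  refine ((integrable_exp_norm_rpow_add_sq d hk0 hk2 (p * M)).const_mul
    ((2 * B) ^ p * Real.exp (-R ^ 2 / 4))).mono' ?_ (ae_of_all _ fun x => ?_)
  · exact ((hc.sub (continuous_clampComp R hc)).abs.measurable.pow_const p).aestronglyMeasurable
  · rw [Real.norm_of_nonneg (by positivity)]
    exact abs_sub_clampComp_rpow_le hM hB hk0 hf hp hR x

/-- The truncation error at `R` in `L^p` is of order `exp(-R²/4)`, uniformly over the class. -/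
lemma integral_abs_sub_clampComp_rpow_le (hM : 0 < M) (hB : 0 < B) (hk0 : 0 < k) (hk2 : k < 2)
    (hf : f ∈ growthClass d M B k) {p : ℝ} (hp : 0 < p) {R : ℝ} (hR : 0 ≤ R) :
    ∫ x, |f x - clampComp R f x| ^ p ∂(stdGaussian (EuclideanSpace ℝ (Fin d))) ≤
      ((2 * B) ^ p * ∫ x, Real.exp (p * M * ‖x‖ ^ k + ‖x‖ ^ 2 / 4)
        ∂(stdGaussian (EuclideanSpace ℝ (Fin d)))) * Real.exp (-R ^ 2 / 4) := by
  rw [mul_right_comm, ← integral_const_mul]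
  exact integral_mono (integrable_abs_sub_clampComp_rpow hM hB hk0 hk2 hf hp hR)
    ((integrable_exp_norm_rpow_add_sq d hk0 hk2 (p * M)).const_mul _)
    (abs_sub_clampComp_rpow_le hM hB hk0 hf hp hR)

/-- A bound for all mixed partial derivatives on the cube `[-R, R]^d`. -/
lemma abs_mixedPartial_le_of_abs_le (hM : 0 < M) (hB : 0 < B) (hk0 : 0 < k)
    (hf : f ∈ growthClass d M B k) {R : ℝ} (u : Finset (Fin d))
    (z : EuclideanSpace ℝ (Fin d)) (hz : ∀ i, |z i| ≤ R) :
    |mixedPartial u f z| ≤ B * Real.exp (M * (d * R ^ 2) ^ (k / 2)) := by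
  refine (hf.2 u z).trans ?_
  have h : ‖z‖ ^ 2 ≤ d * R ^ 2 := by
    rw [EuclideanSpace.norm_sq_eq]
    calc ∑ i, ‖z i‖ ^ 2 ≤ ∑ _i : Fin d, R ^ 2 :=
          Finset.sum_le_sum fun i _ => pow_le_pow_left₀ (norm_nonneg _) (hz i) 2
      _ = d * R ^ 2 := by simp
  rw [norm_rpow_eq]
  gcongr

end GrowthClass

/-! ### The mean error of the estimator -/

section RQMC

variable {Ω : Type*} [MeasurableSpace Ω] {P : Measure Ω} {d n : ℕ} {C : ℝ}
  {y : Fin n → Ω → Fin d → ℝ}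

lemma IsRQMC.aemeasurable (hy : IsRQMC P C y) (j : Fin n) : AEMeasurable (y j) P :=
  (hy.1 j).aemeasurable (by simp [volume_unitCube]) (by simp [volume_unitCube])

lemma IsRQMC.aemeasurable_quantile (hy : IsRQMC P C y) (j : Fin n) :
    AEMeasurable (fun ω => stdNormalQuantileVec (y j ω)) P :=
  measurable_stdNormalQuantileVec.comp_aemeasurable (hy.aemeasurable j)

/-- Each transformed point has the standard normal distribution. -/
lemma IsRQMC.map_quantile (hy : IsRQMC P C y) (j : Fin n) :
    P.map (fun ω => stdNormalQuantileVec (y j ω)) = stdGaussian (EuclideanSpace ℝ (Fin d)) := by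
  rw [← map_stdNormalQuantileVec, ← hy.1 j,
    AEMeasurable.map_map_of_aemeasurable measurable_stdNormalQuantileVec.aemeasurable
      (hy.aemeasurable j)]
  rfl

/-- The points almost surely avoid the faces of the cube, where the quantile function takes its
conventional value. -/
lemma IsRQMC.ae_mem_Ioo (hy : IsRQMC P C y) :
    ∀ᵐ ω ∂P, ∀ j i, 0 < y j ω i ∧ y j ω i < 1 := by
  refine ae_all_iff.2 fun j => ?_
  have h : ∀ᵐ z ∂(P.map (y j)), ∀ i, 0 < z i ∧ z i < 1 := by
    rw [hy.1 j, cond_unitCube]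
    refine ae_all_iff.2 fun i => ?_
    refine (Measure.quasiMeasurePreserving_eval
      (fun _ : Fin d => volume.restrict (Set.Ico (0 : ℝ) 1)) i).ae (p := fun s => 0 < s ∧ s < 1) ?_
    rw [← restrict_Ioo_eq_restrict_Ico]
    exact ae_restrict_mem measurableSet_Ioo
  exact ae_of_ae_map (hy.aemeasurable j) h

lemma IsRQMC.integrable_comp (hy : IsRQMC P C y) (j : Fin n)
    {g : EuclideanSpace ℝ (Fin d) → ℝ} (hg : Integrable g (stdGaussian _)) :
    Integrable (fun ω => g (stdNormalQuantileVec (y j ω))) P := by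
  rw [← hy.map_quantile j] at hg
  exact hg.comp_aemeasurable (hy.aemeasurable_quantile j)

lemma IsRQMC.integral_comp (hy : IsRQMC P C y) (j : Fin n)
    {g : EuclideanSpace ℝ (Fin d) → ℝ} (hg : Integrable g (stdGaussian _)) :
    ∫ ω, g (stdNormalQuantileVec (y j ω)) ∂P = ∫ x, g x ∂(stdGaussian _) := by
  rw [← hy.map_quantile j] at hg ⊢
  rw [integral_map (hy.aemeasurable_quantile j) hg.aestronglyMeasurable]

lemma add_rpow_le_two_rpow_mul {a b q : ℝ} (ha : 0 ≤ a) (hb : 0 ≤ b) (hq : 1 ≤ q) :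
    (a + b) ^ q ≤ 2 ^ (q - 1) * (a ^ q + b ^ q) := by
  lift a to NNReal using ha
  lift b to NNReal using hb
  exact_mod_cast NNReal.rpow_add_le_mul_rpow_add_rpow a b hq

lemma inv_mul_sum_rpow_le (hn : 0 < n) {z : Fin n → ℝ} (hz : ∀ j, 0 ≤ z j) {q : ℝ} (hq : 1 ≤ q) :
    (1 / (n : ℝ) * ∑ j, z j) ^ q ≤ 1 / (n : ℝ) * ∑ j, z j ^ q := by
  rw [Finset.mul_sum, Finset.mul_sum]
  refine Real.rpow_arith_mean_le_arith_mean_rpow _ _ _ (fun j _ => by positivity) ?_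
    (fun j _ => hz j) hq
  have : (n : ℝ) ≠ 0 := by positivity
  simp [this]

/-- Pointwise error: the truncated integrand contributes its own error, and the truncation
itself contributes its mean under the normal distribution and under the empirical measure. -/
lemma abs_rqmcEstimator_sub_le {f g : EuclideanSpace ℝ (Fin d) → ℝ}
    (hf : Integrable f (stdGaussian _)) (hfg : Integrable (fun x => |f x - g x|) (stdGaussian _))
    (hg : Continuous g) (z : Fin n → Fin d → ℝ) :
    |rqmcEstimator f z - ∫ x, f x ∂(stdGaussian _)| ≤
      (|rqmcEstimator g z - ∫ x, g x ∂(stdGaussian _)| + ∫ x, |f x - g x| ∂(stdGaussian _)) +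
        1 / (n : ℝ) * ∑ j, |f (stdNormalQuantileVec (z j)) - g (stdNormalQuantileVec (z j))| := by
  have hfg' : Integrable (fun x => f x - g x) (stdGaussian _) :=
    (integrable_norm_iff (hf.aestronglyMeasurable.sub hg.aestronglyMeasurable)).1 hfg
  have hgi : Integrable g (stdGaussian _) :=
    (hf.sub hfg').congr (ae_of_all _ fun x => by simp)
  have h1 : |∫ x, f x ∂(stdGaussian _) - ∫ x, g x ∂(stdGaussian _)| ≤
      ∫ x, |f x - g x| ∂(stdGaussian _) := by
    rw [← integral_sub hf hgi]
    exact abs_integral_le_integral_abs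
  have h2 : |rqmcEstimator f z - rqmcEstimator g z| ≤
      1 / (n : ℝ) * ∑ j, |f (stdNormalQuantileVec (z j)) - g (stdNormalQuantileVec (z j))| := by
    unfold rqmcEstimator
    rw [← mul_sub, ← Finset.sum_sub_distrib, abs_mul, abs_of_nonneg (by positivity)]
    gcongr
    exact Finset.abs_sum_le_sum_abs _ _
  rw [abs_le] at h1 h2 ⊢
  have h3 := abs_le.1 (le_refl |rqmcEstimator g z - ∫ x, g x ∂(stdGaussian _)|)
  constructor <;> linarith [h1.1, h1.2, h2.1, h2.2, h3.1, h3.2]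

/-- The `q`-th absolute moment of the error, in terms of an almost sure bound `E` for the error of
an approximating integrand `g` and of the distances of `f` and `g` in `L^1` and `L^q`. -/
lemma IsRQMC.integrable_and_integral_error_le [IsProbabilityMeasure P] (hy : IsRQMC P C y)
    (hn : 0 < n) {q E : ℝ} (hq : 1 ≤ q) (hE : 0 ≤ E) {f g : EuclideanSpace ℝ (Fin d) → ℝ}
    (hf : Integrable f (stdGaussian _)) (hfc : Continuous f) (hgc : Continuous g)
    (hfg : Integrable (fun x => |f x - g x|) (stdGaussian _))
    (hfgq : Integrable (fun x => |f x - g x| ^ q) (stdGaussian _))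
    (hg : ∀ᵐ ω ∂P, |rqmcEstimator g (fun j => y j ω) - ∫ x, g x ∂(stdGaussian _)| ≤ E) :
    Integrable (fun ω => |rqmcEstimator f (fun j => y j ω) - ∫ x, f x ∂(stdGaussian _)| ^ q) P ∧
    ∫ ω, |rqmcEstimator f (fun j => y j ω) - ∫ x, f x ∂(stdGaussian _)| ^ q ∂P ≤
      2 ^ (q - 1) * ((E + ∫ x, |f x - g x| ∂(stdGaussian _)) ^ q +
        ∫ x, |f x - g x| ^ q ∂(stdGaussian _)) := by
  set H := ∫ x, |f x - g x| ∂(stdGaussian (EuclideanSpace ℝ (Fin d))) with hH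
  have hH0 : 0 ≤ H := integral_nonneg fun x => abs_nonneg _
  set S : Ω → ℝ := fun ω => 1 / (n : ℝ) *
    ∑ j, |f (stdNormalQuantileVec (y j ω)) - g (stdNormalQuantileVec (y j ω))| ^ q with hS
  have hSi : ∀ j, Integrable
      (fun ω => |f (stdNormalQuantileVec (y j ω)) - g (stdNormalQuantileVec (y j ω))| ^ q) P :=
    fun j => hy.integrable_comp j hfgq
  have hSint : Integrable S P := (integrable_finsetSum _ fun j _ => hSi j).const_mul _
  have hSeq : ∫ ω, S ω ∂P = ∫ x, |f x - g x| ^ q ∂(stdGaussian _) := by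
    have hn' : (n : ℝ) ≠ 0 := by positivity
    rw [integral_const_mul, integral_finsetSum _ fun j _ => hSi j]
    simp_rw [fun j => hy.integral_comp j hfgq]
    simp [hn']
  have hdom : Integrable (fun ω => 2 ^ (q - 1) * ((E + H) ^ q + S ω)) P :=
    ((integrable_const _).add hSint).const_mul _
  have hle : ∀ᵐ ω ∂P, |rqmcEstimator f (fun j => y j ω) - ∫ x, f x ∂(stdGaussian _)| ^ q ≤
      2 ^ (q - 1) * ((E + H) ^ q + S ω) := by
    filter_upwards [hg] with ω hω
    have h1 := abs_rqmcEstimator_sub_le hf hfg hgc fun j => y j ω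
    have h2 := inv_mul_sum_rpow_le hn (z := fun j =>
      |f (stdNormalQuantileVec (y j ω)) - g (stdNormalQuantileVec (y j ω))|)
      (fun j => abs_nonneg _) hq
    refine (Real.rpow_le_rpow (abs_nonneg _)
      (h1.trans (add_le_add_left (add_le_add_left hω H) _)) (by linarith)).trans ?_
    refine (add_rpow_le_two_rpow_mul (by positivity) (by positivity) hq).trans ?_
    gcongr
  have hmeas : AEMeasurable
      (fun ω => |rqmcEstimator f (fun j => y j ω) - ∫ x, f x ∂(stdGaussian _)| ^ q) P := by
    have h : AEMeasurable (fun ω => rqmcEstimator f fun j => y j ω) P := by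
      unfold rqmcEstimator
      refine AEMeasurable.const_mul (Finset.aemeasurable_fun_sum _ fun j _ => ?_) _
      exact hfc.measurable.comp_aemeasurable (hy.aemeasurable_quantile j)
    exact ((continuous_abs.measurable.comp_aemeasurable (h.sub_const _))).pow_const q
  have hint := hdom.mono' hmeas.aestronglyMeasurable (by
    filter_upwards [hle] with ω hω
    rwa [Real.norm_of_nonneg (by positivity)])
  refine ⟨hint, (integral_mono_ae hint hdom hle).trans_eq ?_⟩
  rw [integral_const_mul, integral_add (integrable_const _) hSint, hSeq]
  simp

end RQMC

/-! ### The rate of convergence -/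

/-- The `q`-th root of the rate in the error bound. -/
noncomputable def rate (d : ℕ) (q M k : ℝ) (n : ℕ) : ℝ :=
  (n : ℝ)⁻¹ * Real.log n ^ (3 * (d : ℝ) / 2 - 1) *
    Real.exp (M * (4 * q * d * Real.log n) ^ (k / 2))

lemma rate_rpow (d : ℕ) (q M k : ℝ) (n : ℕ) :
    rate d q M k n ^ q = (n : ℝ) ^ (-q) * Real.log n ^ (q * (3 * d / 2 - 1)) *
      Real.exp (q * M * (4 * q * d * Real.log n) ^ (k / 2)) := by
  have hL : 0 ≤ Real.log n := Real.log_natCast_nonneg n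
  rw [rate, Real.mul_rpow (by positivity) (Real.exp_pos _).le,
    Real.mul_rpow (by positivity) (by positivity), ← Real.exp_mul, ← Real.rpow_mul hL,
    Real.inv_rpow (by positivity), Real.rpow_neg (by positivity)]
  ring_nf

lemma log_two_le_log {n : ℕ} (hn : 2 ≤ n) : Real.log 2 ≤ Real.log n :=
  Real.log_le_log (by norm_num) (by exact_mod_cast hn)

lemma inv_le_rate {d : ℕ} (hd : 1 ≤ d) {q M k : ℝ} (hq : 2 ≤ q) (hM : 0 < M) {n : ℕ}
    (hn : 2 ≤ n) :
    (n : ℝ)⁻¹ ≤ (Real.log 2 ^ (3 * (d : ℝ) / 2 - 1))⁻¹ * rate d q M k n := by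
  have h2 : 0 < Real.log 2 := Real.log_pos (by norm_num)
  have hL := log_two_le_log hn
  have hL0 : 0 < Real.log n := h2.trans_le hL
  have hd' : (1 : ℝ) ≤ d := by exact_mod_cast hd
  have h3 : Real.log 2 ^ (3 * (d : ℝ) / 2 - 1) ≤ Real.log n ^ (3 * (d : ℝ) / 2 - 1) :=
    Real.rpow_le_rpow h2.le hL (by linarith)
  have h4 : 1 ≤ Real.exp (M * (4 * q * d * Real.log n) ^ (k / 2)) :=
    Real.one_le_exp (by positivity)
  have h5 : 0 < Real.log 2 ^ (3 * (d : ℝ) / 2 - 1) := by positivity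
  rw [inv_mul_eq_div, le_div_iff₀ h5, rate]
  calc (n : ℝ)⁻¹ * Real.log 2 ^ (3 * (d : ℝ) / 2 - 1)
      ≤ (n : ℝ)⁻¹ * Real.log n ^ (3 * (d : ℝ) / 2 - 1) := by gcongr
    _ ≤ _ := le_mul_of_one_le_right (by positivity) h4

/-- The Koksma–Hlawka bound for the truncation radius `R = √(4 q log n)`: the factor `(1 + 2R)^d`
contributes the power `d/2` of the logarithm, and the discrepancy contributes the rest. -/
lemma koksma_hlawka_bound_le_rate {d : ℕ} (hd : 1 ≤ d) {q M B k : ℝ} (hq : 2 ≤ q) (hB : 0 < B)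
    (C : ℝ) {n : ℕ} (hn : 2 ≤ n) :
    |C| * Real.log n ^ (d - 1) / n *
      (B * Real.exp (M * (d * √(4 * q * Real.log n) ^ 2) ^ (k / 2))) *
        (1 + 2 * √(4 * q * Real.log n)) ^ d ≤
      |C| * B * ((√(Real.log 2))⁻¹ + 2 * √(4 * q)) ^ d * rate d q M k n := by
  have h2 : 0 < Real.log 2 := Real.log_pos (by norm_num)
  have hL := log_two_le_log hn
  have hL0 : 0 < Real.log n := h2.trans_le hL
  set L := Real.log n with hLdef
  have h1 : 1 + 2 * √(4 * q * L) ≤ ((√(Real.log 2))⁻¹ + 2 * √(4 * q)) * √L := by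
    -- As `log n ≥ log 2`, the constant `1` is absorbed into a multiple of `√(log n)`.
    have h3 : 1 ≤ (√(Real.log 2))⁻¹ * √L := by
      rw [inv_mul_eq_div, one_le_div (Real.sqrt_pos.2 h2)]
      exact Real.sqrt_le_sqrt hL
    rw [Real.sqrt_mul (by linarith)]
    linarith
  have h4 : L ^ (d - 1) * √L ^ d = L ^ (3 * (d : ℝ) / 2 - 1) := by
    rw [← Real.rpow_natCast, Real.sqrt_eq_rpow, ← Real.rpow_natCast, ← Real.rpow_mul hL0.le,
      ← Real.rpow_add hL0]
    congr 1
    push_cast [hd]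
    ring
  have h5 : (d : ℝ) * √(4 * q * L) ^ 2 = 4 * q * d * L := by
    rw [Real.sq_sqrt (by positivity)]; ring
  rw [h5]
  calc _ ≤ |C| * L ^ (d - 1) / n * (B * Real.exp (M * (4 * q * d * L) ^ (k / 2))) *
        (((√(Real.log 2))⁻¹ + 2 * √(4 * q)) * √L) ^ d := by gcongr
    _ = |C| * B * ((√(Real.log 2))⁻¹ + 2 * √(4 * q)) ^ d *
        ((n : ℝ)⁻¹ * (L ^ (d - 1) * √L ^ d) * Real.exp (M * (4 * q * d * L) ^ (k / 2))) := by
      rw [mul_pow]; ring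
    _ = _ := by rw [h4, rate]

lemma exp_neg_sq_sqrt_div_four {q : ℝ} (hq : 2 ≤ q) {n : ℕ} (hn : 2 ≤ n) :
    Real.exp (-√(4 * q * Real.log n) ^ 2 / 4) = ((n : ℝ)⁻¹) ^ q := by
  have hn0 : (0 : ℝ) < n := by positivity
  have hL : 0 ≤ Real.log n := Real.log_natCast_nonneg n
  rw [Real.sq_sqrt (by positivity), Real.rpow_def_of_pos (by positivity), Real.log_inv]
  ring_nf

/-- The moment bound. Truncating at `R = √(4 q log n)` makes both truncation errors of order
`n^(-q)`, and the truncated integrand is handled by the Koksma–Hlawka inequality. -/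
theorem exists_moment_bound (d : ℕ) (hd : 1 ≤ d) (q M B k C : ℝ) (hq : 2 ≤ q) (hM : 0 < M)
    (hB : 0 < B) (hk0 : 0 < k) (hk2 : k < 2) :
    ∃ K : ℝ, 0 ≤ K ∧ ∀ (Ω : Type*) [MeasurableSpace Ω] (P : Measure Ω) [IsProbabilityMeasure P]
      (n : ℕ), 2 ≤ n → ∀ y : Fin n → Ω → Fin d → ℝ, IsRQMC P C y →
      ∀ f ∈ growthClass d M B k,
        Integrable (fun ω => |rqmcEstimator f (fun j => y j ω) -
          ∫ x, f x ∂(stdGaussian (EuclideanSpace ℝ (Fin d)))| ^ q) P ∧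
        ∫ ω, |rqmcEstimator f (fun j => y j ω) -
          ∫ x, f x ∂(stdGaussian (EuclideanSpace ℝ (Fin d)))| ^ q ∂P ≤
          K * rate d q M k n ^ q := by
  set J : ℝ → ℝ := fun p => (2 * B) ^ p * ∫ x, Real.exp (p * M * ‖x‖ ^ k + ‖x‖ ^ 2 / 4)
        ∂(stdGaussian (EuclideanSpace ℝ (Fin d))) with hJ
  have hJ0 : ∀ p, 0 ≤ J p := fun p =>
    mul_nonneg (by positivity) (integral_nonneg fun x => (Real.exp_pos _).le)
  set a := |C| * B * ((√(Real.log 2))⁻¹ + 2 * √(4 * q)) ^ d with ha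
  set b := (Real.log 2 ^ (3 * (d : ℝ) / 2 - 1))⁻¹ with hb
  have h2 : 0 < Real.log 2 := Real.log_pos (by norm_num)
  have ha0 : 0 ≤ a := by positivity
  have hb0 : 0 ≤ b := by positivity
  have hJ1 := hJ0 1
  have hJq := hJ0 q
  refine ⟨2 ^ (q - 1) * ((a + J 1 * b) ^ q + J q * b ^ q), by positivity, ?_⟩
  intro Ω _ P _ n hn y hy f hf
  have hn0 : 0 < n := by omega
  have hL0 : 0 ≤ Real.log n := Real.log_natCast_nonneg n
  set T := rate d q M k n with hT
  have hT0 : 0 ≤ T := by rw [hT, rate]; positivity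
  set R := √(4 * q * Real.log n) with hRdef
  have hR : 0 ≤ R := Real.sqrt_nonneg _
  have hfc := continuous_of_mem_growthClass hf
  have hinv : (n : ℝ)⁻¹ ≤ b * T := inv_le_rate hd hq hM hn
  have hexp : Real.exp (-R ^ 2 / 4) = ((n : ℝ)⁻¹) ^ q := exp_neg_sq_sqrt_div_four hq hn
  -- `C` may be negative; then the hypothesis on the discrepancy still implies the one with `|C|`.
  have hE : ∀ᵐ ω ∂P, |rqmcEstimator (clampComp R f) (fun j => y j ω) -
      ∫ x, clampComp R f x ∂(stdGaussian _)| ≤ a * T := by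
    filter_upwards [hy.2, hy.ae_mem_Ioo] with ω hω hω'
    refine (abs_rqmcEstimator_clampComp_sub_le hn0 hf.1 hR
      (fun u z hz => abs_mixedPartial_le_of_abs_le hM hB hk0 hf u z hz) hω').trans ?_
    refine le_trans ?_ (koksma_hlawka_bound_le_rate hd hq hB C hn)
    have hC : starDiscrepancy (fun j => y j ω) ≤ |C| * Real.log n ^ (d - 1) / n := by
      refine hω.trans ?_
      gcongr
      exact le_abs_self C
    gcongr
  have hi1 := integrable_abs_sub_clampComp_rpow hM hB hk0 hk2 hf one_pos hR
  have hiq := integrable_abs_sub_clampComp_rpow hM hB hk0 hk2 hf (by linarith : 0 < q) hR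
  have hI1 := integral_abs_sub_clampComp_rpow_le hM hB hk0 hk2 hf one_pos hR
  have hIq := integral_abs_sub_clampComp_rpow_le hM hB hk0 hk2 hf (by linarith : 0 < q) hR
  have hpos : 0 ≤ ∫ x, |f x - clampComp R f x| ∂(stdGaussian _) :=
    integral_nonneg fun x => abs_nonneg _
  change _ ≤ J 1 * _ at hI1
  change _ ≤ J q * _ at hIq
  simp only [Real.rpow_one] at hi1 hI1
  rw [hexp] at hI1 hIq
  have hI1' : ∫ x, |f x - clampComp R f x| ∂(stdGaussian _) ≤ J 1 * (b * T) := by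
    refine hI1.trans (mul_le_mul_of_nonneg_left (le_trans ?_ hinv) hJ1)
    have hn1 : (n : ℝ)⁻¹ ≤ 1 := inv_le_one_of_one_le₀ (by exact_mod_cast hn0)
    calc ((n : ℝ)⁻¹) ^ q ≤ ((n : ℝ)⁻¹) ^ (1 : ℝ) :=
          Real.rpow_le_rpow_of_exponent_ge (by positivity) hn1 (by linarith)
      _ = _ := Real.rpow_one _
  have hIq' : ∫ x, |f x - clampComp R f x| ^ q ∂(stdGaussian _) ≤ J q * (b * T) ^ q :=
    hIq.trans (mul_le_mul_of_nonneg_left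
      (Real.rpow_le_rpow (by positivity) hinv (by linarith)) hJq)
  obtain ⟨hint, hle⟩ := hy.integrable_and_integral_error_le hn0 (by linarith : 1 ≤ q)
    (by positivity : 0 ≤ a * T) (integrable_of_mem_growthClass hB hk0 hk2 hf) hfc
    (continuous_clampComp R hfc) hi1 hiq hE
  refine ⟨hint, hle.trans ?_⟩
  calc _ ≤ 2 ^ (q - 1) * ((a * T + J 1 * (b * T)) ^ q + J q * (b * T) ^ q) := by
        gcongr
    _ = _ := by
      rw [show a * T + J 1 * (b * T) = (a + J 1 * b) * T by ring,
        Real.mul_rpow (by positivity) hT0, Real.mul_rpow hb0 hT0]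
      ring

/-- Powers of `L` and `exp(c L^κ)` with `κ < 1` grow more slowly than any `exp(ε L)`. -/
lemma exists_rpow_mul_exp_rpow_le {a c κ ε : ℝ} (ha : 0 < a) (hκ0 : 0 < κ) (hκ1 : κ < 1)
    (hε : 0 < ε) :
    ∃ K : ℝ, 0 ≤ K ∧ ∀ L : ℝ, 0 ≤ L → L ^ a * Real.exp (c * L ^ κ) ≤ K * Real.exp (ε * L) := by
  obtain ⟨K, hK⟩ := exists_mul_rpow_le hκ0 hκ1 c (half_pos hε)
  -- With `δ = ε / (2a)`, the bound `δ L ≤ exp(δ L)` raised to the power `a` controls `L^a`.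
  have hδ : 0 < ε / 2 / a := by positivity
  refine ⟨((ε / 2 / a) ^ a)⁻¹ * Real.exp K, by positivity, fun L hL => ?_⟩
  have h1 : L ^ a ≤ ((ε / 2 / a) ^ a)⁻¹ * Real.exp (ε / 2 * L) := by
    rw [inv_mul_eq_div, le_div_iff₀ (by positivity), ← Real.mul_rpow hL hδ.le]
    have h2 : L * (ε / 2 / a) ≤ Real.exp (L * (ε / 2 / a)) := by
      linarith [Real.add_one_le_exp (L * (ε / 2 / a))]
    refine (Real.rpow_le_rpow (by positivity) h2 ha.le).trans_eq ?_
    rw [← Real.exp_mul]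
    congr 1
    field_simp
  calc L ^ a * Real.exp (c * L ^ κ)
      ≤ ((ε / 2 / a) ^ a)⁻¹ * Real.exp (ε / 2 * L) * Real.exp (ε / 2 * L + K) := by
        gcongr; exact hK L hL
    _ = _ := by
      rw [Real.exp_add, show ε * L = ε / 2 * L + ε / 2 * L by ring, Real.exp_add]; ring

lemma exists_rate_rpow_le {d : ℕ} (hd : 1 ≤ d) {q M k ε : ℝ} (hq : 2 ≤ q) (hk0 : 0 < k)
    (hk2 : k < 2) (hε : 0 < ε) :
    ∃ K : ℝ, 0 ≤ K ∧ ∀ n : ℕ, 2 ≤ n → rate d q M k n ^ q ≤ K * (n : ℝ) ^ (-q + ε) := by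
  have hd' : (1 : ℝ) ≤ d := by exact_mod_cast hd
  have ha : 0 < q * (3 * d / 2 - 1) := mul_pos (by linarith) (by linarith)
  obtain ⟨K, hK0, hK⟩ := exists_rpow_mul_exp_rpow_le (c := q * M * (4 * q * d) ^ (k / 2)) ha
    (by linarith : 0 < k / 2) (by linarith) hε
  refine ⟨K, hK0, fun n hn => ?_⟩
  have hn0 : (0 : ℝ) < n := by positivity
  have hL : 0 ≤ Real.log n := Real.log_natCast_nonneg n
  have h := hK _ hL
  rw [rate_rpow, Real.mul_rpow (by positivity) hL, Real.rpow_add hn0,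
    Real.rpow_def_of_pos hn0 ε, mul_comm (Real.log n) ε, mul_assoc, ← mul_assoc (q * M)]
  calc _ ≤ (n : ℝ) ^ (-q) * (K * Real.exp (ε * Real.log n)) := by gcongr
    _ = _ := by ring

theorem mainTheorem2 (d : ℕ) (hd : 1 ≤ d) (q M B k C : ℝ) (hq : 2 ≤ q) (hM : 0 < M) (hB : 0 < B)
    (hk0 : 0 < k) (hk2 : k < 2) :
    (∀ f ∈ growthClass d M B k, Integrable f (stdGaussian (EuclideanSpace ℝ (Fin d)))) ∧
    (∃ K : ℝ, ∀ (Ω : Type*) [MeasurableSpace Ω] (P : Measure Ω) [IsProbabilityMeasure P]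
      (n : ℕ), 2 ≤ n → ∀ y : Fin n → Ω → Fin d → ℝ, IsRQMC P C y →
      ∀ f ∈ growthClass d M B k,
        Integrable (fun ω => |rqmcEstimator f (fun j => y j ω) -
          ∫ x, f x ∂(stdGaussian (EuclideanSpace ℝ (Fin d)))| ^ q) P ∧
        ∫ ω, |rqmcEstimator f (fun j => y j ω) -
          ∫ x, f x ∂(stdGaussian (EuclideanSpace ℝ (Fin d)))| ^ q ∂P ≤
          K * ((n : ℝ) ^ (-q) * Real.log n ^ (q * (3 * d / 2 - 1)) *
            Real.exp (q * M * (4 * q * d * Real.log n) ^ (k / 2)))) ∧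
    (∀ ε : ℝ, 0 < ε →
      ∃ K : ℝ, ∀ (Ω : Type*) [MeasurableSpace Ω] (P : Measure Ω) [IsProbabilityMeasure P]
        (n : ℕ), 2 ≤ n → ∀ y : Fin n → Ω → Fin d → ℝ, IsRQMC P C y →
        ∀ f ∈ growthClass d M B k,
          ∫ ω, |rqmcEstimator f (fun j => y j ω) -
            ∫ x, f x ∂(stdGaussian (EuclideanSpace ℝ (Fin d)))| ^ q ∂P ≤
            K * (n : ℝ) ^ (-q + ε)) := by
  refine ⟨fun f hf => integrable_of_mem_growthClass hB hk0 hk2 hf, ?_, fun ε hε => ?_⟩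
  · obtain ⟨K, -, hK⟩ := exists_moment_bound d hd q M B k C hq hM hB hk0 hk2
    refine ⟨K, fun Ω _ P _ n hn y hy f hf => ?_⟩
    rw [← rate_rpow]
    exact hK Ω P n hn y hy f hf
  · obtain ⟨K, hK0, hK⟩ := exists_moment_bound d hd q M B k C hq hM hB hk0 hk2
    obtain ⟨K₁, -, hK₁⟩ := exists_rate_rpow_le hd (M := M) hq hk0 hk2 hε
    refine ⟨K * K₁, fun Ω _ P _ n hn y hy f hf => (hK Ω P n hn y hy f hf).2.trans ?_⟩
    rw [mul_assoc]
    exact mul_le_mul_of_nonneg_left (hK₁ n hn) hK0
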